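/- All lattices are finite. For a poset $P$ write $x\prec y$ if $y$ covers $x$. The nullity of $P$ is $p-q+c$, where $p,q,c$ are the numbers of edges, vertices and connected components of its cover graph. $\mathrm{Irr}(P)$ is the set of elements with at most one lower and at most one upper cover, $\mathrm{Red}(P)$ its complement, and $\mathrm{Irr}^*(P)$ the set of elements with exactly one lower and exactly one upper cover. An element $x\in\mathrm{Irr}(P)$ is retractible if either there are no $y,z\in\mathrm{Red}(P)$ with $y\prec x\prec z$, or there are such $y,z$ and there is no other directed path from $y$ to $z$ in the cover graph (edges directed upwards). $P$ is a basic retract if no element of $\mathrm{Irr}^*(P)$ is retractible. The basic block associated to $P$ is obtained from $P$ by successively removing retractible elements of $\mathrm{Irr}^*$ until a basic retract is reached, and then successively removing all pendant vertices of the cover graph. An element $a$ of a lattice is meet-reducible (join-reducible) if $a=b\wedge c$ (respectively $a=b\vee c$) for some $b,c\neq a$, and reducible if it is one or the other. A block is a lattice whose largest element is join-reducible and whose smallest element is meet-reducible. Let $\mathscr{B}(j;4,3)$ be the set of isomorphism classes of blocks on $j$ elements that have exactly four reducible elements, these being pairwise comparable, and have nullity $3$. Let $\mathscr{B}(j;4,3,h)$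 be the subset of those whose associated basic block has height $h$ (length of a longest chain). For a chain $0\prec 1\prec\dots\prec m-1$ and pairs $(a_i,b_i)$ with $a_i+1<b_i$ ($i=1,2,3$), let $A_m(a_1b_1,a_2b_2,a_3b_3)$ be the poset obtained by adding three new elements $c_1,c_2,c_3$, where, for $x$ in the chain, $x\le c_i$ iff $x\le a_i$, $c_i\le x$ iff $b_i\le x$, and $c_i\le c_k$ iff $i=k$ or $b_i\le a_k$. Put $B_1=A_4(13,02,02)$, $B_2=A_4(02,13,13)$, $B_3=A_4(02,13,03)$, $B_4=A_5(13,13,04)$, $B_5=A_5(13,04,04)$, $B_6=A_5(14,24,02)$, $B_7=A_5(03,02,24)$, $B_8=A_5(14,24,04)$, $B_9=A_5(03,02,04)$, $B_{10}=A_5(13,04,03)$, $B_{11}=A_5(13,04,14)$, $B_{12}=A_5(14,03,13)$, $B_{13}=A_6(02,02,35)$, $B_{14}=A_6(35,35,02)$, $B_{15}=A_6(02,24,25)$, $B_{16}=A_6(35,13,03)$, $B_{17}=A_6(35,02,03)$, $B_{18}=A_6(02,35,25)$, $B_{19}=A_6(02,24,05)$, $B_{20}=A_6(35,13,05)$, $B_{21}=A_6(02,35,05)$,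 $B_{22}=A_7(02,24,46)$. Let $\mathbb{B}_i(j;4,3)$ be the subset of $\mathscr{B}(j;4,3)$ of those classes whose associated basic block is isomorphic to $B_i$. Theorem. For every integer $j\ge 7$, $$|\mathscr{B}(j;4,3)|=\sum_{h=3}^{6}|\mathscr{B}(j;4,3,h)|=\sum_{i=1}^{22}|\mathbb{B}_i(j;4,3)|.$$ -/

import Mathlib

/-! ### Finite posets: covers, nullity, irreducible elements -/

/-- The nullity of a poset: (edges) - (vertices) + (connected components) of its cover graph. -/
noncomputable def nullity (P : Type*) [PartialOrder P] : ℤ :=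
  ((SimpleGraph.hasse P).edgeSet.ncard : ℤ) - (Nat.card P : ℤ)
    + (Nat.card (SimpleGraph.hasse P).ConnectedComponent : ℤ)

/-- `x ∈ Irr(P)`: at most one lower cover and at most one upper cover. -/
def IsIrr {P : Type*} [PartialOrder P] (x : P) : Prop :=
  {y : P | y ⋖ x}.Subsingleton ∧ {z : P | x ⋖ z}.Subsingleton

/-- `x ∈ Irr*(P)`: exactly one lower cover and exactly one upper cover. -/
def IsIrrStar {P : Type*} [PartialOrder P] (x : P) : Prop :=
  (∃! y : P, y ⋖ x) ∧ (∃! z : P, x ⋖ z)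

/-- `l` lists the vertices of a directed path from `y` to `z` in the cover graph, every edge being
directed from the smaller to the larger element. -/
def IsDirectedPath {P : Type*} [PartialOrder P] (y z : P) (l : List P) : Prop :=
  l.IsChain (· ⋖ ·) ∧ l.head? = some y ∧ l.getLast? = some z

/-- Retractible elements: `x ∈ Irr(P)` and either there are no `y, z ∈ Red(P)` with `y ≺ x ≺ z`,
or there are such `y, z` and `y ≺ x ≺ z` is the only directed path from `y` to `z`. -/
def Retractible {P : Type*} [PartialOrder P] (x : P) : Prop :=
  IsIrr x ∧
    ((¬ ∃ y z : P, ¬ IsIrr y ∧ ¬ IsIrr z ∧ y ⋖ x ∧ x ⋖ z) ∨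
      (∃ y z : P, ¬ IsIrr y ∧ ¬ IsIrr z ∧ y ⋖ x ∧ x ⋖ z ∧
        ∀ l : List P, IsDirectedPath y z l → l = [y, x, z]))

/-- A poset is a basic retract if no element of `Irr*(P)` is retractible. -/
def IsBasicRetract (P : Type*) [PartialOrder P] : Prop :=
  ∀ x : P, IsIrrStar x → ¬ Retractible x

/-- A pendant vertex: a vertex of degree one in the cover graph. -/
def IsPendant {P : Type*} [PartialOrder P] (x : P) : Prop :=
  ∃! y : P, (SimpleGraph.hasse P).Adj x y

/-- `T` arises from the subposet `S` by removing one retractible element of `Irr*(S)`. -/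
def RetractStep {P : Type*} [PartialOrder P] (S T : Set P) : Prop :=
  ∃ x : S, IsIrrStar x ∧ Retractible x ∧ T = S \ {(x : P)}

/-- `T` arises from the subposet `S` by removing one pendant vertex. -/
def PendantStep {P : Type*} [PartialOrder P] (S T : Set P) : Prop :=
  ∃ x : S, IsPendant x ∧ T = S \ {(x : P)}

/-- `R` is a basic retract associated to `P`: a basic retract reached from `P` by successive
removal of retractible elements of `Irr*`. -/
def IsAssociatedBasicRetract {P : Type*} [PartialOrder P] (R : Set P) : Prop :=
  Relation.ReflTransGen RetractStep Set.univ R ∧ IsBasicRetract R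

/-- `S` is a basic block associated to `P`: obtained from a basic retract associated to `P` by
successive removal of pendant vertices until none is left. -/
def IsAssociatedBasicBlock {P : Type*} [PartialOrder P] (S : Set P) : Prop :=
  ∃ R : Set P, IsAssociatedBasicRetract R ∧ Relation.ReflTransGen PendantStep R S ∧
    ∀ x : S, ¬ IsPendant x

/-! ### Lattices: reducible elements and blocks -/

def MeetReducible {L : Type*} [Lattice L] (a : L) : Prop :=
  ∃ b c : L, b ≠ a ∧ c ≠ a ∧ b ⊓ c = a

def JoinReducible {L : Type*} [Lattice L] (a : L) : Prop :=
  ∃ b c : L, b ≠ a ∧ c ≠ a ∧ b ⊔ c = a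

def Reducible {L : Type*} [Lattice L] (a : L) : Prop :=
  MeetReducible a ∨ JoinReducible a

/-- A block: the largest element is join-reducible and the smallest one is meet-reducible. -/
def IsBlock (L : Type*) [Lattice L] : Prop :=
  (∃ t : L, IsTop t ∧ JoinReducible t) ∧ (∃ s : L, IsBot s ∧ MeetReducible s)

/-- `L` is a block with exactly `r` reducible elements, pairwise comparable, and nullity `k`. -/
def IsBlockWith (L : Type*) [Lattice L] (r k : ℕ) : Prop :=
  IsBlock L ∧ {a : L | Reducible a}.encard = (r : ℕ∞) ∧
    IsChain (· ≤ ·) {a : L | Reducible a} ∧ nullity L = (k : ℤ)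

/-- The basic block associated to `L` has height `h` (the length of a longest chain). -/
def BasicBlockHasHeight (L : Type*) [Lattice L] (h : ℕ) : Prop :=
  ∃ S : Set L, IsAssociatedBasicBlock S ∧ Order.krullDim S = (h : WithBot ℕ∞)

/-- The basic block associated to `L` is isomorphic to `B`. -/
def BasicBlockHasType (L : Type*) [Lattice L] (B : Type*) [PartialOrder B] : Prop :=
  ∃ S : Set L, IsAssociatedBasicBlock S ∧ Nonempty (S ≃o B)

/-! ### Isomorphism classes -/

/-- Isomorphism of lattice structures on the `n`-element set `Fin n` (the usual order of `Fin n`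
plays no role). -/
def latticeSetoid (n : ℕ) : Setoid (Lattice (Fin n)) where
  r A B := Nonempty (@OrderIso (Fin n) (Fin n) A.toLE B.toLE)
  iseqv :=
    { refl := fun A => ⟨@OrderIso.refl (Fin n) A.toLE⟩
      symm := fun {A B} ⟨e⟩ => ⟨@OrderIso.symm (Fin n) (Fin n) A.toLE B.toLE e⟩
      trans := fun {A B C} ⟨e⟩ ⟨f⟩ =>
        ⟨@OrderIso.trans (Fin n) (Fin n) (Fin n) A.toLE B.toLE C.toLE e f⟩ }

/-- Isomorphism classes of lattices on `n` elements. -/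
def LatticeClass (n : ℕ) : Type := Quotient (latticeSetoid n)

instance finite_latticeClass (n : ℕ) : Finite (LatticeClass n) := by
  have : Finite (Lattice (Fin n)) :=
    Finite.of_injective
      (fun (A : Lattice (Fin n)) (x y : Fin n) => A.toLE.le x y)
      (fun A B h => Lattice.ext fun {x y} => iff_of_eq (congrFun (congrFun h x) y))
  exact Quotient.finite _

/-- The isomorphism classes of the lattices on `n` elements that have the property `p`. -/
def classesOf (n : ℕ) (p : Lattice (Fin n) → Prop) : Set (LatticeClass n) :=
  {c | ∃ A : Lattice (Fin n), Quotient.mk (latticeSetoid n) A = c ∧ p A}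

/-- `𝓑(j; r, k)`. -/
def blockClasses (j r k : ℕ) : Set (LatticeClass j) :=
  classesOf j fun A => @IsBlockWith (Fin j) A r k

/-- `𝓑(j; r, k, h)`: the basic block associated to the block has height `h`. -/
def blockClassesOfHeight (j r k h : ℕ) : Set (LatticeClass j) :=
  classesOf j fun A => @IsBlockWith (Fin j) A r k ∧ @BasicBlockHasHeight (Fin j) A h

/-- The classes of `𝓑(j; r, k)` whose associated basic block is isomorphic to `B`. -/
def blockClassesOfType (j r k : ℕ) (B : Type) [PartialOrder B] : Set (LatticeClass j) :=
  classesOf j fun A => @IsBlockWith (Fin j) A r k ∧ @BasicBlockHasType (Fin j) A B _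

/-! ### The twenty-two basic blocks -/

/-- Data of an adjunct `C ]_{a₀}^{b₀} {c₀} ]_{a₁}^{b₁} {c₁} ]_{a₂}^{b₂} {c₂}` of the chain
`C : 0 ≺ 1 ≺ ⋯ ≺ len - 1` with three one-element lattices, all adjunct pairs lying in `C`. -/
structure AdjunctData where
  len : ℕ
  lo : Fin 3 → Fin len
  hi : Fin 3 → Fin len
  /-- `aᵢ < bᵢ`, and `aᵢ` is not covered by `bᵢ` in `C` -/
  gap : ∀ i, (lo i : ℕ) + 1 < hi i

/-- The underlying set: the chain and the three additional elements. -/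
inductive AdjunctData.Elem (D : AdjunctData) : Type
  | chain (x : Fin D.len) : D.Elem
  | extra (i : Fin 3) : D.Elem

/-- The order of the iterated adjunct. -/
def AdjunctData.Elem.le {D : AdjunctData} : D.Elem → D.Elem → Prop
  | .chain x, .chain y => x ≤ y
  | .chain x, .extra i => x ≤ D.lo i
  | .extra i, .chain y => D.hi i ≤ y
  | .extra i, .extra k => i = k ∨ D.hi i ≤ D.lo k

instance AdjunctData.Elem.instPartialOrder (D : AdjunctData) : PartialOrder D.Elem where
  le := AdjunctData.Elem.le
  le_refl x := by cases x <;> simp [AdjunctData.Elem.le]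
  le_trans x y z hxy hyz := by
    have h := D.gap
    cases x <;> cases y <;> cases z <;>
      simp only [AdjunctData.Elem.le, Fin.le_def] at * <;> grind
  le_antisymm x y hxy hyx := by
    have h := D.gap
    cases x <;> cases y <;>
      simp only [AdjunctData.Elem.le, Fin.le_def, AdjunctData.Elem.chain.injEq,
        AdjunctData.Elem.extra.injEq, reduceCtorEq, Fin.ext_iff] at * <;> grind

/-- `B₁, …, B₂₂` (entry `i` of the list is `B_{i+1}`). -/
def basicBlock : Fin 22 → AdjunctData :=
  ![⟨4, ![1, 0, 0], ![3, 2, 2], by decide⟩,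
    ⟨4, ![0, 1, 1], ![2, 3, 3], by decide⟩,
    ⟨4, ![0, 1, 0], ![2, 3, 3], by decide⟩,
    ⟨5, ![1, 1, 0], ![3, 3, 4], by decide⟩,
    ⟨5, ![1, 0, 0], ![3, 4, 4], by decide⟩,
    ⟨5, ![1, 2, 0], ![4, 4, 2], by decide⟩,
    ⟨5, ![0, 0, 2], ![3, 2, 4], by decide⟩,
    ⟨5, ![1, 2, 0], ![4, 4, 4], by decide⟩,
    ⟨5, ![0, 0, 0], ![3, 2, 4], by decide⟩,
    ⟨5, ![1, 0, 0], ![3, 4, 3], by decide⟩,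
    ⟨5, ![1, 0, 1], ![3, 4, 4], by decide⟩,
    ⟨5, ![1, 0, 1], ![4, 3, 3], by decide⟩,
    ⟨6, ![0, 0, 3], ![2, 2, 5], by decide⟩,
    ⟨6, ![3, 3, 0], ![5, 5, 2], by decide⟩,
    ⟨6, ![0, 2, 2], ![2, 4, 5], by decide⟩,
    ⟨6, ![3, 1, 0], ![5, 3, 3], by decide⟩,
    ⟨6, ![3, 0, 0], ![5, 2, 3], by decide⟩,
    ⟨6, ![0, 3, 2], ![2, 5, 5], by decide⟩,
    ⟨6, ![0, 2, 0], ![2, 4, 5], by decide⟩,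
    ⟨6, ![3, 1, 0], ![5, 3, 5], by decide⟩,
    ⟨6, ![0, 3, 0], ![2, 5, 5], by decide⟩,
    ⟨7, ![0, 2, 4], ![2, 4, 6], by decide⟩]

/-!
Deleting a retractible element with one lower and one upper cover contracts a subdivided edge of
the cover graph. It therefore preserves the multigraph on the reducible elements whose edges are
the maximal paths with irreducible interior vertices. In a block with four reducible elements
forming a chain and nullity `3`, this multigraph has four vertices and six edges, all directed
upwards. A basic retract is determined by the multigraph: it has one irreducible element on each
edge, except on an edge that joins two consecutive reducible elements and has no parallel edge. It
has no pendant vertices, so that it is also the basic block. Three of the six edges join consecutive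
reducible elements, and placing the other three so that every vertex remains reducible yields
exactly `B₁, …, B₂₂`, which are pairwise non-isomorphic and have heights `3, …, 6`.
-/

section Irr

variable {P : Type*} [PartialOrder P] {x y z : P}

/-- The set `Red(P)` of elements with several lower or several upper covers. -/
def Red (P : Type*) [PartialOrder P] : Set P := {x | ¬ IsIrr x}

theorem IsIrr.Ioi_eq_Ici [IsStronglyAtomic P] (hx : IsIrr x) (hxz : x ⋖ z) :
    Set.Ioi x = Set.Ici z := by
  refine Set.Subset.antisymm (fun w hxw => ?_) fun w hzw => hxz.lt.trans_le hzw
  obtain ⟨v, hxv, hvw⟩ := exists_covBy_le_of_lt hxw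
  exact (hx.2 hxz hxv).trans_le hvw

theorem IsIrr.Iio_eq_Iic [IsStronglyCoatomic P] (hx : IsIrr x) (hyx : y ⋖ x) :
    Set.Iio x = Set.Iic y := by
  refine Set.Subset.antisymm (fun w hwx => ?_) fun w hwy => lt_of_le_of_lt hwy hyx.lt
  obtain ⟨v, hwv, hvx⟩ := exists_le_covBy_of_lt hwx
  exact hwv.trans_eq (hx.1 hvx hyx)

theorem isDirectedPath_singleton : IsDirectedPath y z [x] ↔ x = y ∧ x = z := by
  simp [IsDirectedPath]

theorem isDirectedPath_cons_cons {w : P} {l : List P} :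
    IsDirectedPath y z (w :: x :: l) ↔ w = y ∧ w ⋖ x ∧ IsDirectedPath x z (x :: l) := by
  simp only [IsDirectedPath, List.isChain_cons_cons, List.head?_cons, Option.some.injEq,
    List.getLast?_cons_cons]
  tauto

theorem IsDirectedPath.exists_eq_cons {l : List P} (h : IsDirectedPath y z l) (hyz : y ≠ z) :
    ∃ v l', l = y :: l' ∧ y ⋖ v ∧ IsDirectedPath v z l' := by
  match l, h with
  | [], ⟨_, h, _⟩ => simp at h
  | [w], h =>
    obtain ⟨rfl, rfl⟩ := isDirectedPath_singleton.1 h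
    exact absurd rfl hyz
  | w :: v :: l, h =>
    obtain ⟨rfl, hwv, hl⟩ := isDirectedPath_cons_cons.1 h
    exact ⟨v, v :: l, rfl, hwv, hl⟩

theorem IsDirectedPath.le {l : List P} (h : IsDirectedPath y z l) : y ≤ z := by
  induction l generalizing y with
  | nil => simp [IsDirectedPath] at h
  | cons w l ih =>
    rcases eq_or_ne y z with rfl | hyz
    · exact le_rfl
    · obtain ⟨v, l, hl, hyv, hvz⟩ := h.exists_eq_cons hyz
      exact hyv.le.trans (ih (List.tail_eq_of_cons_eq hl ▸ hvz))

theorem IsDirectedPath.eq_singleton {l : List P} (h : IsDirectedPath y y l) : l = [y] := by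
  match l, h with
  | [], ⟨_, h, _⟩ => simp at h
  | [w], h => rw [(isDirectedPath_singleton.1 h).1]
  | w :: v :: l, h =>
    obtain ⟨rfl, hwv, hl⟩ := isDirectedPath_cons_cons.1 h
    exact absurd (IsDirectedPath.le hl) hwv.lt.not_ge

theorem exists_isDirectedPath_cons [LocallyFiniteOrder P] (h : y ≤ z) :
    ∃ l, IsDirectedPath y z (y :: l) := by
  obtain ⟨l, hl, hz⟩ :=
    List.exists_isChain_cons_of_relationReflTransGen (le_iff_reflTransGen_covBy.1 h)
  exact ⟨l, hl, rfl, by rw [List.getLast?_eq_some_getLast (List.cons_ne_nil y l), hz]⟩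

theorem forall_isDirectedPath_eq_iff [LocallyFiniteOrder P] (hyx : y ⋖ x) (hxz : x ⋖ z) :
    (∀ l, IsDirectedPath y z l → l = [y, x, z]) ↔ Set.Ioo y z = {x} := by
  constructor
  · intro h
    refine Set.Subset.antisymm (fun w ⟨hyw, hwz⟩ => ?_)
      (Set.singleton_subset_iff.2 ⟨hyx.lt, hxz.lt⟩)
    obtain ⟨v, hyv, hvw⟩ := exists_covBy_le_of_lt hyw
    obtain ⟨l, hl⟩ := exists_isDirectedPath_cons (hvw.trans hwz.le)
    have hpath := h _ (isDirectedPath_cons_cons.2 ⟨rfl, hyv, hl⟩)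
    obtain rfl : v = x := by simp_all
    exact (hxz.eq_or_eq hvw hwz.le).resolve_right hwz.ne
  · intro h l hl
    obtain ⟨v, l, rfl, hyv, hl⟩ := hl.exists_eq_cons (hyx.lt.trans hxz.lt).ne
    have hvz : v ≠ z := by
      rintro rfl
      exact hyv.2 hyx.lt hxz.lt
    obtain rfl : v = x := h.subset ⟨hyv.lt, hl.le.lt_of_ne hvz⟩
    obtain ⟨u, l, rfl, hvu, hl⟩ := hl.exists_eq_cons hvz
    obtain rfl : u = z := (hxz.eq_or_eq hvu.le hl.le).resolve_left hvu.lt.ne'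
    rw [hl.eq_singleton]

theorem Ioo_eq_singleton_of_notMem_red [LocallyFiniteOrder P] (hyx : y ⋖ x) (hxz : x ⋖ z)
    (h : y ∉ Red P ∨ z ∉ Red P) : Set.Ioo y z = {x} := by
  refine Set.Subset.antisymm (fun w ⟨hyw, hwz⟩ => ?_)
    (Set.singleton_subset_iff.2 ⟨hyx.lt, hxz.lt⟩)
  rcases h with hy | hz
  · have hxw : w ∈ Set.Ici x := (not_not.1 hy : IsIrr y).Ioi_eq_Ici hyx ▸ hyw
    exact (hxz.eq_or_eq hxw hwz.le).resolve_right hwz.ne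
  · have hwx : w ∈ Set.Iic x := (not_not.1 hz : IsIrr z).Iio_eq_Iic hxz ▸ hwz
    exact (hyx.eq_or_eq hyw.le hwx).resolve_left hyw.ne'

theorem retractible_iff [LocallyFiniteOrder P] (hx : IsIrr x) (hyx : y ⋖ x) (hxz : x ⋖ z) :
    Retractible x ↔ Set.Ioo y z = {x} := by
  rw [Retractible, and_iff_right hx]
  constructor
  · rintro (h | ⟨y', z', -, -, hy'x, hxz', h⟩)
    · refine Ioo_eq_singleton_of_notMem_red hyx hxz (or_iff_not_and_not.2 fun hyz => h ?_)
      exact ⟨y, z, not_not.1 hyz.1, not_not.1 hyz.2, hyx, hxz⟩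
    · obtain rfl := hx.1 hyx hy'x
      obtain rfl := hx.2 hxz hxz'
      exact (forall_isDirectedPath_eq_iff hyx hxz).1 h
  · intro h
    refine or_iff_not_imp_left.2 fun hred => ?_
    obtain ⟨y', z', hy', hz', hy'x, hxz'⟩ := not_not.1 hred
    obtain rfl := hx.1 hyx hy'x
    obtain rfl := hx.2 hxz hxz'
    exact ⟨y, z, hy', hz', hyx, hxz, (forall_isDirectedPath_eq_iff hyx hxz).2 h⟩

end Irr

section Subdivision

variable {P Q : Type*} [PartialOrder P] [PartialOrder Q] {x y z : P}

theorem subsingleton_covBy_toDual_iff {c : P} :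
    {w : Pᵒᵈ | OrderDual.toDual c ⋖ w}.Subsingleton ↔ {w | w ⋖ c}.Subsingleton := by
  simp only [Set.Subsingleton, Set.mem_ofPred_eq, OrderDual.forall, toDual_covBy_toDual_iff,
    EmbeddingLike.apply_eq_iff_eq]

/-- `x` subdivides a cover `y ≺ z` of the poset without `x`. -/
structure IsSubdivision (y x z : P) : Prop where
  Iio_eq : Set.Iio x = Set.Iic y
  Ioi_eq : Set.Ioi x = Set.Ici z
  Ioo_eq : Set.Ioo y z = {x}

namespace IsSubdivision

theorem lt_iff_le (h : IsSubdivision y x z) {w : P} : w < x ↔ w ≤ y := Set.ext_iff.1 h.Iio_eq w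

theorem gt_iff_ge (h : IsSubdivision y x z) {w : P} : x < w ↔ z ≤ w := Set.ext_iff.1 h.Ioi_eq w

theorem lt_left (h : IsSubdivision y x z) : y < x := h.lt_iff_le.2 le_rfl

theorem lt_right (h : IsSubdivision y x z) : x < z := h.gt_iff_ge.2 le_rfl

protected theorem dual (h : IsSubdivision y x z) :
    IsSubdivision (OrderDual.toDual z) (OrderDual.toDual x) (OrderDual.toDual y) where
  Iio_eq := h.Ioi_eq
  Ioi_eq := h.Iio_eq
  Ioo_eq := by
    ext w
    exact and_comm.trans (Set.ext_iff.1 h.Ioo_eq w.ofDual)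

theorem covBy_right_iff (h : IsSubdivision y x z) {w : P} : x ⋖ w ↔ w = z := by
  constructor
  · intro hxw
    exact ((h.gt_iff_ge.1 hxw.lt).eq_of_not_lt fun hzw => hxw.2 h.lt_right hzw).symm
  · rintro rfl
    exact ⟨h.lt_right, fun v hxv hvw => (h.gt_iff_ge.1 hxv).not_gt hvw⟩

theorem covBy_left_iff (h : IsSubdivision y x z) {w : P} : w ⋖ x ↔ w = y :=
  toDual_covBy_toDual_iff.symm.trans h.dual.covBy_right_iff

theorem isIrr (h : IsSubdivision y x z) : IsIrr x :=
  ⟨fun _ hv _ hw => (h.covBy_left_iff.1 hv).trans (h.covBy_left_iff.1 hw).symm,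
    fun _ hv _ hw => (h.covBy_right_iff.1 hv).trans (h.covBy_right_iff.1 hw).symm⟩

variable {f : Q ↪o P} (hf : Set.range f = {x}ᶜ)

include hf

theorem covBy_iff (h : IsSubdivision y x z) {a b : Q} :
    a ⋖ b ↔ f a ⋖ f b ∨ (f a = y ∧ f b = z) := by
  have exists_of_ne {w : P} (hw : w ≠ x) : ∃ c, f c = w := hf.superset hw
  constructor
  · rintro ⟨hab, hno⟩
    by_cases hc : f a ⋖ f b
    · exact .inl hc
    obtain ⟨w, haw, hwb⟩ := (not_covBy_iff (f.lt_iff_lt.2 hab)).1 hc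
    obtain rfl : w = x := by
      by_contra hwx
      obtain ⟨c, rfl⟩ := exists_of_ne hwx
      exact hno (f.lt_iff_lt.1 haw) (f.lt_iff_lt.1 hwb)
    obtain ⟨a', rfl⟩ := exists_of_ne h.lt_left.ne
    obtain ⟨b', rfl⟩ := exists_of_ne h.lt_right.ne'
    refine .inr ⟨(h.lt_iff_le.1 haw).eq_of_not_lt fun hlt => ?_,
      ((h.gt_iff_ge.1 hwb).eq_of_not_lt fun hlt => ?_).symm⟩
    · exact hno (f.lt_iff_lt.1 hlt) (f.lt_iff_lt.1 (h.lt_left.trans hwb))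
    · exact hno (f.lt_iff_lt.1 (haw.trans h.lt_right)) (f.lt_iff_lt.1 hlt)
  · rintro (hc | ⟨rfl, rfl⟩)
    · exact hc.of_image f
    · refine ⟨f.lt_iff_lt.1 (h.lt_left.trans h.lt_right), fun c hac hcb => ?_⟩
      have : f c ∈ Set.Ioo (f a) (f b) := ⟨f.lt_iff_lt.2 hac, f.lt_iff_lt.2 hcb⟩
      exact hf.subset ⟨c, rfl⟩ (h.Ioo_eq.subset this)

open Classical in
theorem bijOn_upperCovers (h : IsSubdivision y x z) (a : Q) :
    Set.BijOn (Function.update id x z) {w | f a ⋖ w} (f '' {v | a ⋖ v}) := by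
  have ne_x (b : Q) : f b ≠ x := hf.subset ⟨b, rfl⟩
  have exists_of_ne {w : P} (hw : w ≠ x) : ∃ c, f c = w := hf.superset hw
  have not_covBy_z (hx : f a ⋖ x) : ¬ f a ⋖ z := fun hz => hz.2 hx.lt h.lt_right
  refine ⟨fun w hw => ?_, fun v hv w hw hvw => ?_, ?_⟩
  · by_cases hwx : w = x
    · subst hwx
      obtain ⟨b, hb⟩ := exists_of_ne h.lt_right.ne'
      exact ⟨b, (h.covBy_iff hf).2 (.inr ⟨h.covBy_left_iff.1 hw, hb⟩), by simp [hb]⟩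
    · obtain ⟨b, rfl⟩ := exists_of_ne hwx
      exact ⟨b, CovBy.of_image f hw, by simp [hwx]⟩
  · simp only [Function.update_apply, id_eq] at hvw
    split_ifs at hvw with hvx hwx hwx
    · rw [hvx, hwx]
    · exact absurd (hvw ▸ hw) (not_covBy_z (hvx ▸ hv))
    · exact absurd (hvw ▸ hv) (not_covBy_z (hwx ▸ hw))
    · exact hvw
  · rintro _ ⟨b, hb, rfl⟩
    rcases (h.covBy_iff hf).1 hb with hc | ⟨ha, hb⟩
    · exact ⟨f b, hc, by simp [ne_x b]⟩
    · exact ⟨x, h.covBy_left_iff.2 ha, by simp [hb]⟩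

theorem subsingleton_upperCovers_iff (h : IsSubdivision y x z) (a : Q) :
    {w | f a ⋖ w}.Subsingleton ↔ {v | a ⋖ v}.Subsingleton := by
  classical
  rw [← f.injective.subsingleton_image_iff, ← (h.bijOn_upperCovers hf a).image_eq]
  exact ⟨fun hs => hs.image _, fun hs v hv w hw =>
    (h.bijOn_upperCovers hf a).injOn hv hw (hs ⟨v, hv, rfl⟩ ⟨w, hw, rfl⟩)⟩

theorem isIrr_iff (h : IsSubdivision y x z) (a : Q) : IsIrr (f a) ↔ IsIrr a := by
  refine and_congr ?_ (h.subsingleton_upperCovers_iff hf a)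
  rw [← subsingleton_covBy_toDual_iff, ← subsingleton_covBy_toDual_iff]
  exact h.dual.subsingleton_upperCovers_iff (f := f.dual) hf (OrderDual.toDual a)

end IsSubdivision

end Subdivision

section PreservesEdges

variable {P Q : Type*} [PartialOrder P] [PartialOrder Q]

/-- The edges from `s` to `t` in the multigraph on `Red(P)` whose edges are the maximal paths of
the cover graph with irreducible interior vertices. Such a path is encoded by the upper cover of
`s` on it: the elements above that cover have `t` as their least reducible element. -/
def edges (s t : P) : Set P := {v | s ⋖ v ∧ IsLeast {w | w ∈ Red P ∧ v ≤ w} t}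

/-- The map `f` identifies the reducible elements of `Q` and `P` and preserves the number of edges
between them. -/
structure PreservesEdges (f : Q → P) : Prop where
  image_red : f '' Red Q = Red P
  ncard_edges : ∀ s ∈ Red Q, ∀ t, (edges (f s) (f t)).ncard = (edges s t).ncard

theorem PreservesEdges.comp {R : Type*} [PartialOrder R] {g : Q → P} {f : R → Q}
    (hg : PreservesEdges g) (hf : PreservesEdges f) : PreservesEdges (g ∘ f) where
  image_red := by rw [Set.image_comp, hf.image_red, hg.image_red]
  ncard_edges s hs t :=
    (hg.ncard_edges (f s) (hf.image_red.subset ⟨s, hs, rfl⟩) (f t)).trans (hf.ncard_edges s hs t)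

theorem isLeast_red_iff {f : Q ↪o P} (hf : f '' Red Q = Red P) {v t : Q} :
    IsLeast {w | w ∈ Red P ∧ f v ≤ w} (f t) ↔ IsLeast {w | w ∈ Red Q ∧ v ≤ w} t := by
  simp [IsLeast, mem_lowerBounds, ← hf]

theorem isIrr_orderIso_iff (e : Q ≃o P) (a : Q) : IsIrr (e a) ↔ IsIrr a := by
  simp only [IsIrr, Set.Subsingleton, Set.mem_ofPred_eq, e.surjective.forall, apply_covBy_apply_iff,
    EmbeddingLike.apply_eq_iff_eq]

theorem preservesEdges_orderIso (e : Q ≃o P) : PreservesEdges e := by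
  have image_red : e '' Red Q = Red P := by
    ext w
    obtain ⟨a, rfl⟩ := e.surjective w
    rw [e.injective.mem_set_image]
    exact (isIrr_orderIso_iff e a).not.symm
  refine ⟨image_red, fun s _ t => ?_⟩
  have himage : edges (e s) (e t) = e '' edges s t := by
    ext w
    obtain ⟨v, rfl⟩ := e.surjective w
    rw [e.injective.mem_set_image]
    exact and_congr (apply_covBy_apply_iff e) (isLeast_red_iff (f := e.toOrderEmbedding) image_red)
  rw [himage, Set.ncard_image_of_injective _ e.injective]

theorem IsSubdivision.isLeast_red_update_iff [DecidableEq P] {y x z t : P}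
    (h : IsSubdivision y x z) (v : P) :
    IsLeast {w | w ∈ Red P ∧ Function.update id x z v ≤ w} t ↔
      IsLeast {w | w ∈ Red P ∧ v ≤ w} t := by
  rcases eq_or_ne v x with rfl | hvx
  · have hred : {w | w ∈ Red P ∧ z ≤ w} = {w | w ∈ Red P ∧ v ≤ w} := by
      ext w
      refine and_congr_right fun hw => ?_
      rw [← h.gt_iff_ge, lt_iff_le_and_ne, and_iff_left]
      rintro rfl
      exact hw h.isIrr
    rw [Function.update_self, hred]
  · rw [Function.update_of_ne hvx, id_eq]

theorem IsSubdivision.preservesEdges {y x z : P} (h : IsSubdivision y x z) {f : Q ↪o P}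
    (hf : Set.range f = {x}ᶜ) : PreservesEdges f := by
  classical
  have image_red : f '' Red Q = Red P := by
    ext w
    constructor
    · rintro ⟨a, ha, rfl⟩
      exact (h.isIrr_iff hf a).not.2 ha
    · intro hw
      obtain ⟨a, rfl⟩ : w ∈ Set.range f := hf.superset fun hwx => hw (hwx ▸ h.isIrr)
      exact ⟨a, (h.isIrr_iff hf a).not.1 hw, rfl⟩
  refine ⟨image_red, fun s _ t => ?_⟩
  have himage : f '' edges s t =
      f '' {v | s ⋖ v} ∩ {w | IsLeast {u | u ∈ Red P ∧ w ≤ u} (f t)} := by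
    rw [← Set.image_inter_preimage]
    exact congrArg _ (Set.ext fun v => and_congr_right' (isLeast_red_iff image_red).symm)
  have hbij : Set.BijOn (Function.update id x z) (edges (f s) (f t)) (f '' edges s t) := by
    rw [himage]
    exact (h.bijOn_upperCovers hf s).inter_mapsTo
      (fun v hv => (h.isLeast_red_update_iff v).2 hv)
      fun v hv => (h.isLeast_red_update_iff v).1 hv.2
  rw [hbij.ncard_eq, Set.ncard_image_of_injective _ f.injective]

theorem RetractStep.exists_isSubdivision [Finite P] {S T : Set P} (h : RetractStep S T) :
    ∃ y x z : S, IsSubdivision y x z ∧ T = S \ {(x : P)} := by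
  classical
  let _ := Fintype.ofFinite S
  let _ : LocallyFiniteOrder S := Fintype.toLocallyFiniteOrder
  obtain ⟨x, ⟨⟨y, hyx, -⟩, z, hxz, -⟩, hx, rfl⟩ := h
  exact ⟨y, x, z, ⟨hx.1.Iio_eq_Iic hyx, hx.1.Ioi_eq_Ici hxz, (retractible_iff hx.1 hyx hxz).1 hx⟩,
    rfl⟩

theorem preservesEdges_val_of_reflTransGen [Finite P] {S : Set P}
    (h : Relation.ReflTransGen RetractStep Set.univ S) : PreservesEdges ((↑) : S → P) := by
  induction h with
  | refl => exact preservesEdges_orderIso (OrderIso.Set.univ : (Set.univ : Set P) ≃o P)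
  | @tail S T _ hST ih =>
    obtain ⟨y, x, z, hx, rfl⟩ := hST.exists_isSubdivision
    let f : ↥(S \ {(x : P)}) ↪o S := Subtype.orderEmbedding fun _ h => h.1
    refine ih.comp (hx.preservesEdges (f := f) ?_)
    ext w
    exact ⟨fun ⟨v, hv⟩ hw => v.2.2 (congrArg Subtype.val (hv.trans hw)),
      fun hw => ⟨⟨w, w.2, fun h => hw (Subtype.ext h)⟩, rfl⟩⟩

end PreservesEdges

section RedChain

variable {P ι : Type*} [PartialOrder P] [LinearOrder ι]

/-- `r` lists the reducible elements of `P` in increasing order, the first being the least and the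
last the greatest element of `P`. -/
structure IsRedChain [BoundedOrder ι] (r : ι → P) : Prop where
  strictMono : StrictMono r
  range_eq : Set.range r = Red P
  isBot : IsBot (r ⊥)
  isTop : IsTop (r ⊤)

namespace IsRedChain

variable [BoundedOrder ι] {r : ι → P} {x y : P} {a b : ι}

theorem comp_preservesEdges {Q : Type*} [PartialOrder Q] {f : Q ↪o P} (hr : IsRedChain r)
    (hf : PreservesEdges f) : ∃ s : ι → Q, IsRedChain s ∧ ∀ a, f (s a) = r a := by
  have hmem (a : ι) : ∃ q, q ∈ Red Q ∧ f q = r a :=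
    hf.image_red.superset (hr.range_eq.subset ⟨a, rfl⟩)
  choose s hs hsr using hmem
  refine ⟨s, ⟨fun a b hab => ?_, ?_, fun q => ?_, fun q => ?_⟩, hsr⟩
  · rw [← f.lt_iff_lt, hsr, hsr]
    exact hr.strictMono hab
  · refine Set.Subset.antisymm (Set.range_subset_iff.2 hs) fun q hq => ?_
    obtain ⟨a, ha⟩ := hr.range_eq.superset (hf.image_red.subset ⟨q, hq, rfl⟩)
    exact ⟨a, f.injective ((hsr a).trans ha)⟩
  · rw [← f.le_iff_le, hsr]
    exact hr.isBot _
  · rw [← f.le_iff_le, hsr]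
    exact hr.isTop _

theorem mem_red (hr : IsRedChain r) (a : ι) : r a ∈ Red P := hr.range_eq.subset ⟨a, rfl⟩

theorem exists_eq_of_mem_red (hr : IsRedChain r) (hx : x ∈ Red P) : ∃ a, r a = x :=
  hr.range_eq.superset hx

theorem ne_of_notMem_red (hr : IsRedChain r) (hx : x ∉ Red P) (a : ι) : r a ≠ x := by
  rintro rfl
  exact hx (hr.mem_red a)

theorem isIrrStar_of_notMem_red [IsStronglyAtomic P] [IsStronglyCoatomic P] (hr : IsRedChain r)
    (hx : x ∉ Red P) : IsIrrStar x := by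
  have hirr : IsIrr x := not_not.1 hx
  obtain ⟨y, -, hyx⟩ :=
    exists_le_covBy_of_lt ((hr.isBot x).lt_of_ne (hr.ne_of_notMem_red hx ⊥))
  obtain ⟨z, hxz, -⟩ :=
    exists_covBy_le_of_lt ((hr.isTop x).lt_of_ne (hr.ne_of_notMem_red hx ⊤).symm)
  exact ⟨⟨y, hyx, fun _ h => hirr.1 h hyx⟩, ⟨z, hxz, fun _ h => hirr.2 h hxz⟩⟩

theorem not_isPendant [IsStronglyAtomic P] [IsStronglyCoatomic P] (hr : IsRedChain r) (x : P) :
    ¬ IsPendant x := by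
  rintro ⟨w, -, hw⟩
  have eq_of_covBy {v : P} (hv : v ⋖ x ∨ x ⋖ v) : v = w := hw v (SimpleGraph.hasse_adj.2 hv.symm)
  have hirr : IsIrr x :=
    ⟨fun _ hu _ hv => (eq_of_covBy (.inl hu)).trans (eq_of_covBy (.inl hv)).symm,
      fun _ hu _ hv => (eq_of_covBy (.inr hu)).trans (eq_of_covBy (.inr hv)).symm⟩
  obtain ⟨⟨y, hyx, -⟩, z, hxz, -⟩ := hr.isIrrStar_of_notMem_red (not_not.2 hirr)
  exact (hyx.lt.trans hxz.lt).ne ((eq_of_covBy (.inl hyx)).trans (eq_of_covBy (.inr hxz)).symm)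

theorem exists_gc_lo [Finite ι] (hr : IsRedChain r) : ∃ lo : P → ι, GaloisConnection r lo := by
  have hmax (x : P) : ∃ b, ∀ a, r a ≤ x ↔ a ≤ b := by
    obtain ⟨b, hb, hmax⟩ := Set.exists_max_image {a | r a ≤ x} id (Set.toFinite _) ⟨⊥, hr.isBot x⟩
    exact ⟨b, fun a => ⟨hmax a, fun hab => (hr.strictMono.monotone hab).trans hb⟩⟩
  choose lo hlo using hmax
  exact ⟨lo, fun a x => hlo x a⟩

theorem exists_gc_hi [Finite ι] (hr : IsRedChain r) : ∃ hi : P → ι, GaloisConnection hi r := by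
  have hmin (x : P) : ∃ b, ∀ a, x ≤ r a ↔ b ≤ a := by
    obtain ⟨b, hb, hmin⟩ := Set.exists_min_image {a | x ≤ r a} id (Set.toFinite _) ⟨⊤, hr.isTop x⟩
    exact ⟨b, fun a => ⟨hmin a, fun hab => hb.trans (hr.strictMono.monotone hab)⟩⟩
  choose hi hhi using hmin
  exact ⟨hi, fun x a => (hhi x a).symm⟩

variable {lo hi : P → ι}

theorem lo_apply (hr : IsRedChain r) (hlo : GaloisConnection r lo) (a : ι) : lo (r a) = a :=
  eq_of_forall_le_iff fun c => (hlo c (r a)).symm.trans hr.strictMono.le_iff_le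

theorem hi_apply (hr : IsRedChain r) (hhi : GaloisConnection hi r) (a : ι) : hi (r a) = a :=
  eq_of_forall_ge_iff fun c => (hhi (r a) c).trans hr.strictMono.le_iff_le

theorem mem_edges_iff (hr : IsRedChain r) (hhi : GaloisConnection hi r) :
    x ∈ edges (r a) (r b) ↔ r a ⋖ x ∧ hi x = b := by
  have hred : {w | w ∈ Red P ∧ x ≤ w} = r '' Set.Ici (hi x) := by
    ext w
    constructor
    · rintro ⟨hw, hxw⟩
      obtain ⟨c, rfl⟩ := hr.exists_eq_of_mem_red hw
      exact ⟨c, (hhi x c).2 hxw, rfl⟩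
    · rintro ⟨c, hc, rfl⟩
      exact ⟨hr.mem_red c, (hhi x c).1 hc⟩
  rw [edges, Set.mem_ofPred_eq, hred, hr.strictMono.map_isLeast]
  exact and_congr_right' ⟨fun h => isLeast_Ici.unique h, fun h => h ▸ isLeast_Ici⟩

theorem ncard_upperCovers [Finite P] [Fintype ι] (hr : IsRedChain r) (a : ι) :
    {x | r a ⋖ x}.ncard = ∑ b, (edges (r a) (r b)).ncard := by
  obtain ⟨hi, hhi⟩ := hr.exists_gc_hi
  have hunion : {x | r a ⋖ x} = ⋃ b, edges (r a) (r b) := by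
    ext x
    simp [hr.mem_edges_iff hhi]
  have hdisj : Pairwise fun b c => Disjoint (edges (r a) (r b)) (edges (r a) (r c)) :=
    fun b c hbc => Set.disjoint_left.2 fun x hb hc =>
      hbc (((hr.mem_edges_iff hhi).1 hb).2.symm.trans ((hr.mem_edges_iff hhi).1 hc).2)
  rw [hunion, Set.ncard_iUnion_of_finite (fun _ => Set.toFinite _) hdisj, finsum_eq_sum_of_fintype]

theorem ncard_edges_eq_zero (hr : IsRedChain r) (hba : b ≤ a) :
    (edges (r a) (r b)).ncard = 0 := by
  have hempty : edges (r a) (r b) = ∅ := Set.eq_empty_iff_forall_notMem.2 fun x ⟨hax, hxb⟩ =>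
    hax.lt.not_ge (hxb.1.2.trans (hr.strictMono.monotone hba))
  rw [hempty, Set.ncard_empty]

theorem ncard_edges_pos [Finite P] [Finite ι] (hr : IsRedChain r) (hab : a ⋖ b) :
    0 < (edges (r a) (r b)).ncard := by
  obtain ⟨hi, hhi⟩ := hr.exists_gc_hi
  obtain ⟨v, hav, hvb⟩ := exists_covBy_le_of_lt (hr.strictMono hab.lt)
  have hlt : a < hi v := not_le.1 fun h => hav.lt.not_ge ((hhi v a).1 h)
  have heq : hi v = b := (hab.eq_or_eq hlt.le ((hhi v b).2 hvb)).resolve_left hlt.ne'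
  exact (Set.ncard_pos (Set.toFinite _)).2 ⟨v, (hr.mem_edges_iff hhi).2 ⟨hav, heq⟩⟩

end IsRedChain

end RedChain

section Nullity

variable {P : Type*} [PartialOrder P]

theorem ncard_edgeSet_hasse [Fintype P] :
    (SimpleGraph.hasse P).edgeSet.ncard = ∑ x : P, {y | x ⋖ y}.ncard := by
  have himage : (SimpleGraph.hasse P).edgeSet = (fun p : P × P => s(p.1, p.2)) ''
      {p | p.1 ⋖ p.2} := by
    ext e
    induction e with
    | _ x y =>
      simp only [SimpleGraph.mem_edgeSet, SimpleGraph.hasse_adj, Set.mem_image, Prod.exists,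
        Sym2.eq_iff, Set.mem_ofPred_eq]
      aesop
  have hinj : Set.InjOn (fun p : P × P => s(p.1, p.2)) {p | p.1 ⋖ p.2} := by
    rintro ⟨a, b⟩ hab ⟨c, d⟩ hcd h
    rcases Sym2.eq_iff.1 h with ⟨rfl, rfl⟩ | ⟨rfl, rfl⟩
    · rfl
    · exact absurd hab.lt (lt_asymm hcd.lt)
  rw [himage, hinj.ncard_image, ← Nat.card_coe_set_eq]
  exact (Nat.card_congr (Equiv.subtypeProdEquivSigmaSubtype fun x y : P => x ⋖ y)).trans
    Nat.card_sigma

theorem card_connectedComponent_hasse [Finite P] {s : P} (hs : IsBot s) :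
    Nat.card (SimpleGraph.hasse P).ConnectedComponent = 1 := by
  have reachable_bot (x : P) : (SimpleGraph.hasse P).Reachable s x := by
    induction x using (wellFounded_lt (α := P)).induction with
    | _ x ih =>
      rcases (hs x).eq_or_lt with rfl | hlt
      · exact .refl _
      · obtain ⟨y, -, hy⟩ := exists_le_covBy_of_lt hlt
        exact (ih y hy.1).trans (SimpleGraph.hasse_adj.2 (.inl hy)).reachable
  have hpre : (SimpleGraph.hasse P).Preconnected :=
    fun x y => (reachable_bot x).symm.trans (reachable_bot y)
  rw [Nat.card_eq_one_iff_unique]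
  exact ⟨hpre.subsingleton_connectedComponent, ⟨SimpleGraph.connectedComponentMk _ s⟩⟩

theorem IsRedChain.nullity_add_card [Finite P] {ι : Type*} [LinearOrder ι] [BoundedOrder ι]
    [Fintype ι] {r : ι → P} (hr : IsRedChain r) :
    nullity P + Fintype.card ι = ∑ a, ∑ b, (edges (r a) (r b)).ncard + 1 := by
  have := Fintype.ofFinite P
  have upperCovers_irr (x : P) (hx : x ∉ Set.range r) : ({y | x ⋖ y}.ncard : ℤ) - 1 = 0 := by
    obtain ⟨z, hxz, hz⟩ := (hr.isIrrStar_of_notMem_red (hr.range_eq ▸ hx)).2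
    rw [show {y | x ⋖ y} = {z} from Set.ext fun y => ⟨hz y, fun h => h ▸ hxz⟩,
      Set.ncard_singleton, Nat.cast_one, sub_self]
  have hsum : ∑ a, (({y | r a ⋖ y}.ncard : ℤ) - 1) = ∑ x : P, (({y | x ⋖ y}.ncard : ℤ) - 1) :=
    Fintype.sum_of_injective r hr.strictMono.injective _ _ upperCovers_irr fun _ => rfl
  rw [nullity, ncard_edgeSet_hasse, card_connectedComponent_hasse hr.isBot,
    Nat.card_eq_fintype_card]
  simp only [Finset.sum_sub_distrib, hr.ncard_upperCovers, Finset.sum_const, Finset.card_univ,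
    nsmul_eq_mul, mul_one] at hsum
  push_cast at hsum ⊢
  linarith

end Nullity

section BasicRetract

variable {Q ι : Type*} [PartialOrder Q] [LinearOrder ι]

/-- `x ≤ y` in `Q` holds only for the obvious reason that the label `hi x` of `x` is at most the
label `lo y` of `y`: distinct elements behave like the intervals `[lo x, hi x]` of the chain `ι`. -/
def IsIntervalLabelling (lo hi : Q → ι) : Prop :=
  ∀ x y, x ≤ y ↔ x = y ∨ hi x ≤ lo y

theorem IsIntervalLabelling.nonempty_orderIso {Q' : Type*} [PartialOrder Q'] [Finite Q] [Finite Q']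
    {lo hi : Q → ι} {lo' hi' : Q' → ι} (h : IsIntervalLabelling lo hi)
    (h' : IsIntervalLabelling lo' hi')
    (hcard : ∀ a b, {x | lo x = a ∧ hi x = b}.ncard = {x | lo' x = a ∧ hi' x = b}.ncard) :
    Nonempty (Q ≃o Q') := by
  have fibre_equiv (c : ι × ι) :
      Nonempty ({x // (lo x, hi x) = c} ≃ {x // (lo' x, hi' x) = c}) := by
    rw [← Finite.card_eq]
    simp only [Prod.ext_iff]
    exact (Nat.card_coe_set_eq _).trans ((hcard c.1 c.2).trans (Nat.card_coe_set_eq _).symm)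
  let e : Q ≃ Q' := Equiv.ofFiberEquiv fun c => (fibre_equiv c).some
  have hlabels (x : Q) : (lo' (e x), hi' (e x)) = (lo x, hi x) :=
    Equiv.ofFiberEquiv_map (g := fun y => (lo' y, hi' y)) (fun c => (fibre_equiv c).some) x
  have hlo (x : Q) : lo' (e x) = lo x := congrArg Prod.fst (hlabels x)
  have hhi (x : Q) : hi' (e x) = hi x := congrArg Prod.snd (hlabels x)
  exact ⟨⟨e, fun {x y} => by rw [h x y, h' (e x) (e y), hlo, hhi, e.injective.eq_iff]⟩⟩

/-- The number of elements with labels `lo x = a` and `hi x = b` in a basic retract with edge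
multiplicities `m`. An edge between consecutive reducible elements that has no parallel edge is a
cover, so that no element lies on it. -/
def placeCount [DecidableRel (α := ι) (· ⋖ ·)] (m : ι → ι → ℕ) (a b : ι) : ℕ :=
  if a = b then 1 else if a ⋖ b ∧ m a b = 1 then 0 else m a b

theorem IsBasicRetract.Ioo_ne_singleton [Finite Q] (hQ : IsBasicRetract Q) {x y z : Q}
    (hx : IsIrrStar x) (hyx : y ⋖ x) (hxz : x ⋖ z) : Set.Ioo y z ≠ {x} := by
  classical
  let _ := Fintype.ofFinite Q
  let _ : LocallyFiniteOrder Q := Fintype.toLocallyFiniteOrder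
  have hirr : IsIrr x := ⟨fun _ h _ h' => hx.1.unique h h', fun _ h _ h' => hx.2.unique h h'⟩
  exact (retractible_iff hirr hyx hxz).not.1 (hQ x hx)

theorem IsBasicRetract.mem_red_of_covBy [Finite Q] (hQ : IsBasicRetract Q) {x y z : Q}
    (hx : IsIrrStar x) (hyx : y ⋖ x) (hxz : x ⋖ z) : y ∈ Red Q ∧ z ∈ Red Q := by
  classical
  let _ := Fintype.ofFinite Q
  let _ : LocallyFiniteOrder Q := Fintype.toLocallyFiniteOrder
  rw [← not_not (a := _ ∧ _), not_and_or]
  exact fun h => hQ.Ioo_ne_singleton hx hyx hxz (Ioo_eq_singleton_of_notMem_red hyx hxz h)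

namespace IsRedChain

variable [BoundedOrder ι] {r : ι → Q} {lo hi : Q → ι} {x : Q} {a b : ι}

theorem notMem_red_of_lo_ne_hi (hr : IsRedChain r) (hlo : GaloisConnection r lo)
    (hhi : GaloisConnection hi r) (hx : lo x ≠ hi x) : x ∉ Red Q := by
  intro hred
  obtain ⟨a, rfl⟩ := hr.exists_eq_of_mem_red hred
  rw [hr.lo_apply hlo, hr.hi_apply hhi] at hx
  exact hx rfl

theorem fibre_self (hr : IsRedChain r) (hlo : GaloisConnection r lo)
    (hhi : GaloisConnection hi r) (a : ι) : {x | lo x = a ∧ hi x = a} = {r a} := by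
  ext x
  constructor
  · rintro ⟨hlox, hhix⟩
    exact ((hhi x a).1 hhix.le).antisymm ((hlo a x).2 hlox.ge)
  · rintro rfl
    exact ⟨hr.lo_apply hlo a, hr.hi_apply hhi a⟩

theorem edges_eq_singleton (hr : IsRedChain r) (hhi : GaloisConnection hi r) (hcov : r a ⋖ r b) :
    edges (r a) (r b) = {r b} := by
  ext x
  rw [hr.mem_edges_iff hhi, Set.mem_singleton_iff]
  constructor
  · rintro ⟨hax, rfl⟩
    exact (hcov.eq_or_eq hax.le (hhi.le_u_l x)).resolve_left hax.ne'
  · rintro rfl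
    exact ⟨hcov, hr.hi_apply hhi b⟩

theorem fibre_eq_Ioo (hr : IsRedChain r) (hlo : GaloisConnection r lo)
    (hhi : GaloisConnection hi r) (hab : a ⋖ b) :
    {x | lo x = a ∧ hi x = b} = Set.Ioo (r a) (r b) := by
  ext x
  constructor
  · rintro ⟨rfl, rfl⟩
    have hx := hr.notMem_red_of_lo_ne_hi hlo hhi hab.ne
    exact ⟨(hlo.l_u_le x).lt_of_ne (hr.ne_of_notMem_red hx _),
      (hhi.le_u_l x).lt_of_ne (hr.ne_of_notMem_red hx _).symm⟩
  · rintro ⟨hax, hxb⟩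
    have hlob : lo x < b := not_le.1 fun h => hxb.not_ge ((hlo b x).2 h)
    have hhia : a < hi x := not_le.1 fun h => hax.not_ge ((hhi x a).1 h)
    exact ⟨(hab.eq_or_eq ((hlo a x).1 hax.le) hlob.le).resolve_right hlob.ne,
      (hab.eq_or_eq hhia.le ((hhi x b).2 hxb.le)).resolve_left hhia.ne'⟩

variable [Finite Q]

theorem lo_covBy (hQ : IsBasicRetract Q) (hr : IsRedChain r) (hlo : GaloisConnection r lo)
    (hx : x ∉ Red Q) : r (lo x) ⋖ x := by
  obtain ⟨⟨y, hyx, -⟩, z, hxz, -⟩ := hr.isIrrStar_of_notMem_red hx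
  obtain ⟨a, rfl⟩ := hr.exists_eq_of_mem_red
    (hQ.mem_red_of_covBy (hr.isIrrStar_of_notMem_red hx) hyx hxz).1
  have hlt : r (lo x) < x := (hlo.l_u_le x).lt_of_ne (hr.ne_of_notMem_red hx _)
  have hle : r a ≤ r (lo x) := hr.strictMono.monotone ((hlo a x).1 hyx.le)
  rwa [(hyx.eq_or_eq hle hlt.le).resolve_right hlt.ne]

theorem covBy_hi (hQ : IsBasicRetract Q) (hr : IsRedChain r) (hhi : GaloisConnection hi r)
    (hx : x ∉ Red Q) : x ⋖ r (hi x) := by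
  obtain ⟨⟨y, hyx, -⟩, z, hxz, -⟩ := hr.isIrrStar_of_notMem_red hx
  obtain ⟨a, rfl⟩ := hr.exists_eq_of_mem_red
    (hQ.mem_red_of_covBy (hr.isIrrStar_of_notMem_red hx) hyx hxz).2
  have hlt : x < r (hi x) := (hhi.le_u_l x).lt_of_ne (hr.ne_of_notMem_red hx _).symm
  have hle : r (hi x) ≤ r a := hr.strictMono.monotone ((hhi x a).2 hxz.le)
  rwa [(hxz.eq_or_eq hlt.le hle).resolve_left hlt.ne']

theorem isIntervalLabelling (hQ : IsBasicRetract Q) (hr : IsRedChain r)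
    (hlo : GaloisConnection r lo) (hhi : GaloisConnection hi r) : IsIntervalLabelling lo hi := by
  refine fun x y => ⟨fun hxy => or_iff_not_imp_left.2 fun hne => ?_, ?_⟩
  · by_cases hx : x ∈ Red Q
    · obtain ⟨a, rfl⟩ := hr.exists_eq_of_mem_red hx
      rwa [hr.hi_apply hhi, ← hlo a y]
    · have hy : y ∈ Set.Ioi x := hxy.lt_of_ne hne
      rw [(not_not.1 hx : IsIrr x).Ioi_eq_Ici (hr.covBy_hi hQ hhi hx)] at hy
      exact (hlo _ _).1 hy
  · rintro (rfl | h)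
    · exact le_rfl
    · exact (hhi.le_u_l x).trans ((hlo _ _).2 h)

theorem fibre_eq_edges (hQ : IsBasicRetract Q) (hr : IsRedChain r) (hlo : GaloisConnection r lo)
    (hhi : GaloisConnection hi r) (hab : a ≠ b) (hcov : ¬ r a ⋖ r b) :
    {x | lo x = a ∧ hi x = b} = edges (r a) (r b) := by
  ext x
  rw [hr.mem_edges_iff hhi]
  constructor
  · rintro ⟨rfl, rfl⟩
    exact ⟨hr.lo_covBy hQ hlo (hr.notMem_red_of_lo_ne_hi hlo hhi hab), rfl⟩
  · rintro ⟨hax, rfl⟩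
    refine ⟨?_, rfl⟩
    have hx : x ∉ Red Q := fun hx => by
      obtain ⟨c, rfl⟩ := hr.exists_eq_of_mem_red hx
      rw [hr.hi_apply hhi] at hcov
      exact hcov hax
    have hle : r a ≤ r (lo x) := hr.strictMono.monotone ((hlo a x).1 hax.le)
    have hlt := (hr.lo_covBy hQ hlo hx).lt
    exact hr.strictMono.injective ((hax.eq_or_eq hle hlt.le).resolve_right hlt.ne)

theorem fibre_eq_empty (hQ : IsBasicRetract Q) (hr : IsRedChain r) (hlo : GaloisConnection r lo)
    (hhi : GaloisConnection hi r) (hcov : r a ⋖ r b) : {x | lo x = a ∧ hi x = b} = ∅ := by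
  refine Set.eq_empty_iff_forall_notMem.2 ?_
  rintro x ⟨rfl, rfl⟩
  have hx := hr.notMem_red_of_lo_ne_hi hlo hhi fun h => hcov.lt.ne (congrArg r h)
  exact hcov.2 (hr.lo_covBy hQ hlo hx).lt (hr.covBy_hi hQ hhi hx).lt

theorem ncard_fibre_ne_one (hQ : IsBasicRetract Q) (hr : IsRedChain r)
    (hlo : GaloisConnection r lo) (hhi : GaloisConnection hi r) (hab : a ⋖ b) :
    {x | lo x = a ∧ hi x = b}.ncard ≠ 1 := by
  intro hone
  obtain ⟨x, hx⟩ := Set.ncard_eq_one.1 hone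
  obtain ⟨rfl, rfl⟩ : lo x = a ∧ hi x = b := hx.superset rfl
  have hred := hr.notMem_red_of_lo_ne_hi hlo hhi hab.ne
  exact hQ.Ioo_ne_singleton (hr.isIrrStar_of_notMem_red hred) (hr.lo_covBy hQ hlo hred)
    (hr.covBy_hi hQ hhi hred) ((hr.fibre_eq_Ioo hlo hhi hab).symm.trans hx)

theorem ncard_fibre_eq_placeCount [DecidableRel (α := ι) (· ⋖ ·)]
    (hQ : IsBasicRetract Q) (hr : IsRedChain r) (hlo : GaloisConnection r lo)
    (hhi : GaloisConnection hi r) (a b : ι) : {x | lo x = a ∧ hi x = b}.ncard =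
      placeCount (fun a b => (edges (r a) (r b)).ncard) a b := by
  simp only [placeCount]
  by_cases hab : a = b
  · rw [if_pos hab, ← hab, hr.fibre_self hlo hhi, Set.ncard_singleton]
  rw [if_neg hab]
  by_cases hcov : r a ⋖ r b
  · have hab' : a ⋖ b := hcov.of_image (OrderEmbedding.ofStrictMono r hr.strictMono)
    rw [hr.fibre_eq_empty hQ hlo hhi hcov, hr.edges_eq_singleton hhi hcov, Set.ncard_singleton,
      if_pos ⟨hab', rfl⟩, Set.ncard_empty]
  · rw [hr.fibre_eq_edges hQ hlo hhi hab hcov, if_neg]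
    rintro ⟨hab', hone⟩
    rw [← hr.fibre_eq_edges hQ hlo hhi hab hcov] at hone
    exact hr.ncard_fibre_ne_one hQ hlo hhi hab' hone

theorem ncard_lowerCovers_le [Fintype ι] (hQ : IsBasicRetract Q) (hr : IsRedChain r) (b : ι) :
    {x | x ⋖ r b}.ncard ≤ ∑ a, (edges (r a) (r b)).ncard := by
  obtain ⟨lo, hlo⟩ := hr.exists_gc_lo
  obtain ⟨hi, hhi⟩ := hr.exists_gc_hi
  have hcovers (a : ι) : {x | x ⋖ r b ∧ lo x = a}.ncard ≤ (edges (r a) (r b)).ncard := by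
    by_cases hcov : r a ⋖ r b
    · rw [hr.edges_eq_singleton hhi hcov, Set.ncard_singleton, ← Set.ncard_singleton (r a)]
      refine Set.ncard_le_ncard ?_
      rintro x ⟨hxb, rfl⟩
      exact (hcov.eq_or_eq (hlo.l_u_le x) hxb.le).resolve_right hxb.ne
    · refine Set.ncard_le_ncard ?_ (Set.toFinite _)
      rintro x ⟨hxb, rfl⟩
      have hx : x ∉ Red Q := fun hx => by
        obtain ⟨c, rfl⟩ := hr.exists_eq_of_mem_red hx
        rw [hr.lo_apply hlo] at hcov
        exact hcov hxb
      exact (hr.mem_edges_iff hhi).2 ⟨hr.lo_covBy hQ hlo hx, hr.strictMono.injective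
        ((not_not.1 hx : IsIrr x).2 (hr.covBy_hi hQ hhi hx) hxb)⟩
  have hunion : {x | x ⋖ r b} = ⋃ a, {x | x ⋖ r b ∧ lo x = a} := by
    ext x
    simp
  rw [hunion]
  refine (Set.ncard_iUnion_le_of_fintype _).trans ?_
  exact Finset.sum_le_sum fun a _ => hcovers a

end IsRedChain

end BasicRetract

section Associated

variable {P ι : Type*} [PartialOrder P] [LinearOrder ι] [BoundedOrder ι] {r : ι → P}

namespace IsRedChain

theorem exists_isIntervalLabelling [Finite ι] [DecidableRel (α := ι) (· ⋖ ·)] {Q : Type*}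
    [PartialOrder Q] [Finite Q] {f : Q ↪o P} (hr : IsRedChain r) (hf : PreservesEdges f)
    (hQ : IsBasicRetract Q) : ∃ lo hi : Q → ι, IsIntervalLabelling lo hi ∧ ∀ a b,
      {x | lo x = a ∧ hi x = b}.ncard = placeCount (fun a b => (edges (r a) (r b)).ncard) a b := by
  obtain ⟨s, hs, hsr⟩ := hr.comp_preservesEdges hf
  obtain ⟨lo, hlo⟩ := hs.exists_gc_lo
  obtain ⟨hi, hhi⟩ := hs.exists_gc_hi
  refine ⟨lo, hi, hs.isIntervalLabelling hQ hlo hhi, fun a b => ?_⟩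
  simp only [← hsr, hf.ncard_edges _ (hs.mem_red _)]
  exact hs.ncard_fibre_eq_placeCount hQ hlo hhi a b

theorem nonempty_orderIso_of_isBasicRetract [Finite ι] {Q Q' : Type*} [PartialOrder Q] [Finite Q]
    [PartialOrder Q'] [Finite Q'] {f : Q ↪o P} {f' : Q' ↪o P} (hr : IsRedChain r)
    (hf : PreservesEdges f) (hf' : PreservesEdges f') (hQ : IsBasicRetract Q)
    (hQ' : IsBasicRetract Q') : Nonempty (Q ≃o Q') := by
  classical
  obtain ⟨lo, hi, h, hcount⟩ := hr.exists_isIntervalLabelling hf hQ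
  obtain ⟨lo', hi', h', hcount'⟩ := hr.exists_isIntervalLabelling hf' hQ'
  exact h.nonempty_orderIso h' fun a b => (hcount a b).trans (hcount' a b).symm

end IsRedChain

theorem exists_isAssociatedBasicRetract (P : Type*) [PartialOrder P] [Finite P] :
    ∃ R : Set P, IsAssociatedBasicRetract R := by
  obtain ⟨R, hR, hmin⟩ := Set.Finite.exists_minimalFor Set.ncard
    {R : Set P | Relation.ReflTransGen RetractStep Set.univ R} (Set.toFinite _) ⟨_, .refl⟩
  refine ⟨R, hR, fun x hx hret => ?_⟩
  have hlt : (R \ {(x : P)}).ncard < R.ncard := Set.ncard_sdiff_singleton_lt_of_mem x.2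
  exact hlt.not_ge (hmin (hR.tail ⟨x, hx, hret, rfl⟩) hlt.le)

theorem IsAssociatedBasicRetract.preservesEdges [Finite P] {R : Set P}
    (hR : IsAssociatedBasicRetract R) : PreservesEdges (OrderEmbedding.subtype (· ∈ R)) :=
  preservesEdges_val_of_reflTransGen hR.1

variable [Finite P]

namespace IsRedChain

theorem isAssociatedBasicBlock_iff (hr : IsRedChain r) {S : Set P} :
    IsAssociatedBasicBlock S ↔ IsAssociatedBasicRetract S := by
  have not_isPendant_of {R : Set P} (hR : IsAssociatedBasicRetract R) (x : R) : ¬ IsPendant x := by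
    obtain ⟨s, hs, -⟩ := hr.comp_preservesEdges hR.preservesEdges
    exact hs.not_isPendant x
  constructor
  · rintro ⟨R, hR, hRS, -⟩
    rcases hRS.cases_head with rfl | ⟨T, ⟨x, hx, -⟩, -⟩
    · exact hR
    · exact absurd hx (not_isPendant_of hR x)
  · exact fun hS => ⟨S, hS, .refl, not_isPendant_of hS⟩

theorem two_le_sum_ncard_edges [Fintype ι] (hr : IsRedChain r) (c : ι) :
    2 ≤ ∑ b, (edges (r c) (r b)).ncard ∨ 2 ≤ ∑ a, (edges (r a) (r c)).ncard := by
  obtain ⟨R, hR⟩ := exists_isAssociatedBasicRetract P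
  obtain ⟨s, hs, hsr⟩ := hr.comp_preservesEdges hR.preservesEdges
  simp only [← hsr, hR.preservesEdges.ncard_edges _ (hs.mem_red _)]
  have hc : ¬ IsIrr (s c) := hs.mem_red c
  rw [IsIrr, not_and_or, Set.not_subsingleton_iff, Set.not_subsingleton_iff] at hc
  rcases hc with hlower | hupper
  · exact .inr ((Set.one_lt_ncard_iff_nontrivial.2 hlower).trans_le
      (hs.ncard_lowerCovers_le hR.2 c))
  · exact .inl ((Set.one_lt_ncard_iff_nontrivial.2 hupper).trans_eq (hs.ncard_upperCovers c))

end IsRedChain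

end Associated

section Lattice

variable {L : Type*} [Lattice L] {a : L}

theorem meetReducible_iff [IsStronglyAtomic L] :
    MeetReducible a ↔ {v | a ⋖ v}.Nontrivial := by
  constructor
  · rintro ⟨b, c, hb, hc, rfl⟩
    obtain ⟨u, hu, hub⟩ := exists_covBy_le_of_lt (inf_le_left.lt_of_ne hb.symm)
    obtain ⟨v, hv, hvc⟩ := exists_covBy_le_of_lt (inf_le_right.lt_of_ne hc.symm)
    refine ⟨u, hu, v, hv, ?_⟩
    rintro rfl
    exact hu.lt.not_ge (le_inf hub hvc)
  · rintro ⟨u, hu, v, hv, huv⟩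
    exact ⟨u, v, hu.ne', hv.ne', (CovBy.wcovBy hu).inf_eq (CovBy.wcovBy hv) huv⟩

theorem joinReducible_iff [IsStronglyCoatomic L] :
    JoinReducible a ↔ {u | u ⋖ a}.Nontrivial := by
  constructor
  · rintro ⟨b, c, hb, hc, rfl⟩
    obtain ⟨u, hub, hu⟩ := exists_le_covBy_of_lt (le_sup_left.lt_of_ne hb)
    obtain ⟨v, hvc, hv⟩ := exists_le_covBy_of_lt (le_sup_right.lt_of_ne hc)
    refine ⟨u, hu, v, hv, ?_⟩
    rintro rfl
    exact hu.lt.not_ge (sup_le hub hvc)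
  · rintro ⟨u, hu, v, hv, huv⟩
    exact ⟨u, v, hu.ne, hv.ne, (CovBy.wcovBy hu).sup_eq (CovBy.wcovBy hv) huv⟩

theorem mem_red_iff_reducible [IsStronglyAtomic L] [IsStronglyCoatomic L] :
    a ∈ Red L ↔ Reducible a := by
  rw [Reducible, meetReducible_iff, joinReducible_iff, ← Set.not_subsingleton_iff,
    ← Set.not_subsingleton_iff, or_comm, ← not_and_or]
  rfl

theorem IsBlockWith.exists_isRedChain [Finite L] {n k : ℕ} [NeZero n] (h : IsBlockWith L n k) :
    ∃ r : Fin n → L, IsRedChain r := by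
  classical
  have := Fintype.ofFinite L
  obtain ⟨⟨⟨t, ht, htr⟩, s, hs, hsr⟩, hcard, hchain, -⟩ := h
  let _ : LinearOrder {a : L | Reducible a} := hchain.linearOrder
  have hn : Fintype.card {a : L | Reducible a} = n := by
    rw [← Nat.card_eq_fintype_card, Nat.card_coe_set_eq, Set.ncard, hcard, ENat.toNat_natCast]
  let e := Fintype.orderIsoFinOfCardEq {a : L | Reducible a} hn
  have hbot : e ⊥ ≤ ⟨s, .inl hsr⟩ := by
    rw [← e.le_symm_apply]
    exact bot_le
  have htop : ⟨t, .inr htr⟩ ≤ e ⊤ := by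
    rw [← e.symm_apply_le]
    exact le_top
  refine ⟨fun a => e a, fun a b hab => e.strictMono hab, ?_,
    fun x => le_trans (show (e ⊥ : L) ≤ s from hbot) (hs x),
    fun x => (ht x).trans (show t ≤ (e ⊤ : L) from htop)⟩
  ext a
  rw [mem_red_iff_reducible]
  exact ⟨fun ⟨b, hb⟩ => hb ▸ (e b).2, fun ha => ⟨e.symm ⟨a, ha⟩, by simp⟩⟩

end Lattice

section Adjunct

namespace AdjunctData

variable (D : AdjunctData)

theorem Elem.le_iff {D : AdjunctData} {x y : D.Elem} : x ≤ y ↔ Elem.le x y := Iff.rfl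

/-- The elements of an adjunct, as a disjoint union of the chain and the additional elements. -/
def Elem.equivSum : D.Elem ≃ Fin D.len ⊕ Fin 3 where
  toFun
    | .chain x => .inl x
    | .extra i => .inr i
  invFun := Sum.elim .chain .extra
  left_inv x := by cases x <;> rfl
  right_inv x := by cases x <;> rfl

instance : Fintype D.Elem := Fintype.ofEquiv _ (Elem.equivSum D).symm

instance : DecidableEq D.Elem := (Elem.equivSum D).decidableEq

instance : DecidableLE D.Elem
  | .chain x, .chain y => inferInstanceAs (Decidable (x ≤ y))
  | .chain x, .extra i => inferInstanceAs (Decidable (x ≤ D.lo i))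
  | .extra i, .chain y => inferInstanceAs (Decidable (D.hi i ≤ y))
  | .extra i, .extra k => inferInstanceAs (Decidable (i = k ∨ D.hi i ≤ D.lo k))

/-- The height of an element of an adjunct within the chain or just above the lower element of its
adjunct pair, which shows that the adjunct is as high as its chain. -/
def Elem.rank {D : AdjunctData} : D.Elem → Fin D.len
  | .chain x => x
  | .extra i => ⟨D.lo i + 1, (D.gap i).trans (D.hi i).2⟩

theorem Elem.rank_strictMono : StrictMono (Elem.rank (D := D)) := by
  intro x y hxy
  have hgap := D.gap
  rw [lt_iff_le_not_ge, Elem.le_iff, Elem.le_iff] at hxy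
  cases x <;> cases y <;>
    simp only [Elem.le, Elem.rank, Fin.le_def, Fin.lt_def] at * <;> grind

theorem Elem.chain_strictMono : StrictMono (Elem.chain (D := D)) := by
  intro x y hxy
  rw [lt_iff_le_not_ge, Elem.le_iff, Elem.le_iff]
  exact lt_iff_le_not_ge.1 hxy

theorem krullDim_elem : Order.krullDim D.Elem = Order.krullDim (Fin D.len) :=
  (Order.krullDim_le_of_strictMono _ (Elem.rank_strictMono D)).antisymm
    (Order.krullDim_le_of_strictMono _ (Elem.chain_strictMono D))

/-- The lower end of an element: the element itself in the chain, and otherwise the lower element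
of its adjunct pair. -/
def Elem.lower {D : AdjunctData} : D.Elem → Fin D.len
  | .chain x => x
  | .extra i => D.lo i

/-- The upper end of an element: the element itself in the chain, and otherwise the upper element
of its adjunct pair. -/
def Elem.upper {D : AdjunctData} : D.Elem → Fin D.len
  | .chain x => x
  | .extra i => D.hi i

/-- The end points of the adjunct pairs. In a basic block these are the four reducible elements. -/
def ends : Finset (Fin D.len) := Finset.univ.image D.lo ∪ Finset.univ.image D.hi

/-- The position of the largest end point below an element among the end points, counted
from `0`. The value is reduced modulo `4`, which has no effect on the basic blocks. -/
def loLabel {D : AdjunctData} (x : D.Elem) : Fin 4 :=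
  Fin.ofNat 4 ((D.ends.filter (· ≤ x.lower)).card - 1)

/-- The position of the smallest end point above an element among the end points, counted
from `0`. The value is reduced modulo `4`, which has no effect on the basic blocks. -/
def hiLabel {D : AdjunctData} (x : D.Elem) : Fin 4 :=
  Fin.ofNat 4 (D.ends.filter (· < x.upper)).card

end AdjunctData

theorem krullDim_fin_succ (n : ℕ) : Order.krullDim (Fin (n + 1)) = n := by
  refine le_antisymm (iSup_le fun l => ?_)
    (Order.le_krullDim_iff.2 ⟨LTSeries.mk n id strictMono_id, rfl⟩)
  exact_mod_cast Nat.lt_succ_iff.1 (l.length_lt_card.trans_eq (Fintype.card_fin _))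

theorem krullDim_elem_eq_iff {D : AdjunctData} {h : ℕ} :
    Order.krullDim D.Elem = h ↔ D.len = h + 1 := by
  obtain ⟨n, hn⟩ := Nat.exists_eq_add_one.2 (D.lo 0).pos
  rw [D.krullDim_elem, hn, krullDim_fin_succ]
  norm_cast
  exact Nat.succ_inj.symm

theorem isIntervalLabelling_basicBlock (i : Fin 22) :
    IsIntervalLabelling (AdjunctData.loLabel (D := basicBlock i)) AdjunctData.hiLabel := by
  have le_iff : ∀ i, ∀ x y : (basicBlock i).Elem,
      x ≤ y ↔ x = y ∨ AdjunctData.hiLabel x ≤ AdjunctData.loLabel y := by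
    decide +kernel
  exact le_iff i

/-- The sizes of the principal ideals and filters of a finite poset, a numerical invariant which
distinguishes the basic blocks. -/
def coneProfile (P : Type*) [PartialOrder P] [Fintype P] [DecidableLE P] : Multiset (ℕ × ℕ) :=
  Finset.univ.val.map fun x : P =>
    ((Finset.univ.filter (· ≤ x)).card, (Finset.univ.filter (x ≤ ·)).card)

theorem coneProfile_congr {P Q : Type*} [PartialOrder P] [Fintype P] [DecidableLE P]
    [PartialOrder Q] [Fintype Q] [DecidableLE Q] (e : P ≃o Q) : coneProfile P = coneProfile Q := by
  rw [coneProfile, coneProfile, ← Multiset.map_univ_val_equiv e.toEquiv, Multiset.map_map]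
  refine Multiset.map_congr rfl fun x _ => Prod.ext ?_ ?_
  · exact Finset.card_equiv e.toEquiv fun y => by simp
  · exact Finset.card_equiv e.toEquiv fun y => by simp

theorem eq_of_orderIso_basicBlock {i k : Fin 22} (e : (basicBlock i).Elem ≃o (basicBlock k).Elem) :
    i = k := by
  have coneProfile_injective : ∀ i k : Fin 22,
      coneProfile (basicBlock i).Elem = coneProfile (basicBlock k).Elem → i = k := by
    decide +kernel
  exact coneProfile_injective i k (coneProfile_congr e)

instance decidableCovByFin {n : ℕ} : DecidableRel (α := Fin n) (· ⋖ ·) := fun a b =>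
  decidable_of_iff ((a : ℕ) + 1 = b) (Nat.covBy_iff_add_one_eq.symm.trans Fin.covBy_iff.symm)

/-- A multigraph on the chain `0 < 1 < 2 < 3` with edges directed upwards, where `e₀₁`, `e₁₂` and
`e₂₃` count the edges between consecutive vertices apart from one that is always present. -/
def edgeMatrix (e₀₁ e₁₂ e₂₃ e₀₂ e₁₃ e₀₃ : ℕ) : Fin 4 → Fin 4 → ℕ :=
  ![![0, e₀₁ + 1, e₀₂, e₀₃], ![0, 0, e₁₂ + 1, e₁₃], ![0, 0, 0, e₂₃ + 1], ![0, 0, 0, 0]]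

theorem exists_eq_edgeMatrix {m : Fin 4 → Fin 4 → ℕ} (hzero : ∀ a b, b ≤ a → m a b = 0)
    (hpos : ∀ a b, a ⋖ b → 0 < m a b) :
    ∃ e₀₁ e₁₂ e₂₃ e₀₂ e₁₃ e₀₃, m = edgeMatrix e₀₁ e₁₂ e₂₃ e₀₂ e₁₃ e₀₃ := by
  obtain ⟨e₀₁, h₀₁⟩ := Nat.exists_eq_add_one.2 (hpos 0 1 (by decide))
  obtain ⟨e₁₂, h₁₂⟩ := Nat.exists_eq_add_one.2 (hpos 1 2 (by decide))
  obtain ⟨e₂₃, h₂₃⟩ := Nat.exists_eq_add_one.2 (hpos 2 3 (by decide))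
  refine ⟨e₀₁, e₁₂, e₂₃, m 0 2, m 1 3, m 0 3, ?_⟩
  funext a b
  fin_cases a <;> fin_cases b <;>
    first | exact hzero _ _ (by decide) | rfl | exact h₀₁ | exact h₁₂ | exact h₂₃

theorem exists_card_fibre_eq_placeCount_edgeMatrix : ∀ e₀₁ e₁₂ e₂₃ e₀₂ e₁₃ e₀₃ : Fin 4,
    ∑ a, ∑ b, edgeMatrix e₀₁ e₁₂ e₂₃ e₀₂ e₁₃ e₀₃ a b = 6 →
    (∀ c, 2 ≤ ∑ b, edgeMatrix e₀₁ e₁₂ e₂₃ e₀₂ e₁₃ e₀₃ c b ∨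
      2 ≤ ∑ a, edgeMatrix e₀₁ e₁₂ e₂₃ e₀₂ e₁₃ e₀₃ a c) →
    ∃ i, ∀ a b, (Finset.univ.filter fun x : (basicBlock i).Elem =>
      AdjunctData.loLabel x = a ∧ AdjunctData.hiLabel x = b).card =
      placeCount (edgeMatrix e₀₁ e₁₂ e₂₃ e₀₂ e₁₃ e₀₃) a b := by
  decide +kernel

theorem exists_ncard_fibre_eq_placeCount {m : Fin 4 → Fin 4 → ℕ}
    (hzero : ∀ a b, b ≤ a → m a b = 0) (hpos : ∀ a b, a ⋖ b → 0 < m a b)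
    (hsum : ∑ a, ∑ b, m a b = 6) (hred : ∀ c, 2 ≤ ∑ b, m c b ∨ 2 ≤ ∑ a, m a c) :
    ∃ i, ∀ a b, {x : (basicBlock i).Elem |
      AdjunctData.loLabel x = a ∧ AdjunctData.hiLabel x = b}.ncard = placeCount m a b := by
  obtain ⟨e₀₁, e₁₂, e₂₃, e₀₂, e₁₃, e₀₃, rfl⟩ := exists_eq_edgeMatrix hzero hpos
  have hextra : e₀₁ + e₁₂ + e₂₃ + e₀₂ + e₁₃ + e₀₃ = 3 := by
    simp only [edgeMatrix, Matrix.cons_val', Matrix.cons_val_fin_one, Fin.sum_univ_four,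
      Fin.isValue, Matrix.cons_val_zero, Matrix.cons_val_one, Matrix.cons_val, zero_add,
      add_zero] at hsum
    omega
  obtain ⟨i, hi⟩ := exists_card_fibre_eq_placeCount_edgeMatrix ⟨e₀₁, by omega⟩ ⟨e₁₂, by omega⟩
    ⟨e₂₃, by omega⟩ ⟨e₀₂, by omega⟩ ⟨e₁₃, by omega⟩ ⟨e₀₃, by omega⟩ hsum hred
  refine ⟨i, fun a b => ?_⟩
  rw [← hi, ← Set.ncard_coe_finset, Finset.coe_filter_univ]

end Adjunct

section BasicBlocks

namespace IsBlockWith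

variable {L L' : Type*} [Lattice L] [Finite L] [Lattice L'] [Finite L']

theorem exists_orderIso_basicBlock (h : IsBlockWith L 4 3) {S : Set L}
    (hS : IsAssociatedBasicBlock S) : ∃ i, Nonempty (S ≃o (basicBlock i).Elem) := by
  obtain ⟨r, hr⟩ := h.exists_isRedChain
  have hR := hr.isAssociatedBasicBlock_iff.1 hS
  obtain ⟨bot, top, hlabel, hlabelCount⟩ := hr.exists_isIntervalLabelling hR.preservesEdges hR.2
  have hsum : ∑ a, ∑ b, (edges (r a) (r b)).ncard = 6 := by
    have hnull := hr.nullity_add_card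
    rw [h.2.2.2, Fintype.card_fin] at hnull
    norm_cast at hnull
    omega
  obtain ⟨i, hplaceCount⟩ := exists_ncard_fibre_eq_placeCount (fun a b => hr.ncard_edges_eq_zero)
    (fun a b => hr.ncard_edges_pos) hsum hr.two_le_sum_ncard_edges
  exact ⟨i, hlabel.nonempty_orderIso (isIntervalLabelling_basicBlock i) fun a b =>
    (hlabelCount a b).trans (hplaceCount a b).symm⟩

theorem exists_basicBlockHasType (h : IsBlockWith L 4 3) :
    ∃ i, BasicBlockHasType L (basicBlock i).Elem := by
  obtain ⟨r, hr⟩ := h.exists_isRedChain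
  obtain ⟨S, hS⟩ := exists_isAssociatedBasicRetract L
  rw [← hr.isAssociatedBasicBlock_iff] at hS
  obtain ⟨i, hi⟩ := h.exists_orderIso_basicBlock hS
  exact ⟨i, S, hS, hi⟩

theorem nonempty_orderIso_of_isAssociatedBasicBlock {n k : ℕ} [NeZero n] (h : IsBlockWith L n k)
    (h' : IsBlockWith L' n k) (e : L' ≃o L) {S : Set L} {S' : Set L'}
    (hS : IsAssociatedBasicBlock S) (hS' : IsAssociatedBasicBlock S') : Nonempty (S ≃o S') := by
  obtain ⟨r, hr⟩ := h.exists_isRedChain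
  obtain ⟨r', hr'⟩ := h'.exists_isRedChain
  have hR := hr.isAssociatedBasicBlock_iff.1 hS
  have hR' := hr'.isAssociatedBasicBlock_iff.1 hS'
  exact hr.nonempty_orderIso_of_isBasicRetract hR.preservesEdges
    (f' := (OrderEmbedding.subtype (· ∈ S')).trans e.toOrderEmbedding)
    ((preservesEdges_orderIso e).comp hR'.preservesEdges) hR.2 hR'.2

theorem eq_of_basicBlockHasType {n k : ℕ} [NeZero n] (h : IsBlockWith L n k)
    (h' : IsBlockWith L' n k) (e : L' ≃o L) {i i' : Fin 22}
    (hi : BasicBlockHasType L (basicBlock i).Elem)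
    (hi' : BasicBlockHasType L' (basicBlock i').Elem) : i = i' := by
  obtain ⟨S, hS, ⟨f⟩⟩ := hi
  obtain ⟨S', hS', ⟨f'⟩⟩ := hi'
  obtain ⟨g⟩ := h.nonempty_orderIso_of_isAssociatedBasicBlock h' e hS hS'
  exact eq_of_orderIso_basicBlock (f.symm.trans (g.trans f'))

theorem basicBlockHasHeight_iff (h : IsBlockWith L 4 3) {n : ℕ} :
    BasicBlockHasHeight L n ↔
      ∃ i, (basicBlock i).len = n + 1 ∧ BasicBlockHasType L (basicBlock i).Elem := by
  constructor
  · rintro ⟨S, hS, hdim⟩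
    obtain ⟨i, ⟨e⟩⟩ := h.exists_orderIso_basicBlock hS
    rw [Order.krullDim_eq_of_orderIso e, krullDim_elem_eq_iff] at hdim
    exact ⟨i, hdim, S, hS, ⟨e⟩⟩
  · rintro ⟨i, hlen, S, hS, ⟨e⟩⟩
    exact ⟨S, hS, (Order.krullDim_eq_of_orderIso e).trans (krullDim_elem_eq_iff.2 hlen)⟩

end IsBlockWith

end BasicBlocks

section Counting

variable (j : ℕ)

theorem pairwise_disjoint_blockClassesOfType :
    Pairwise (Function.onFun Disjoint fun i => blockClassesOfType j 4 3 (basicBlock i).Elem) := by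
  refine fun i i' hne => Set.disjoint_left.2 ?_
  rintro _ ⟨A, rfl, hA, hi⟩ ⟨A', hAA', hA', hi'⟩
  obtain ⟨e⟩ := Quotient.exact hAA'
  exact hne (@IsBlockWith.eq_of_basicBlockHasType _ _ A _ A' _ 4 3 _ hA hA' e _ _ hi hi')

theorem ncard_biUnion_blockClassesOfType (s : Finset (Fin 22)) :
    (⋃ i ∈ s, blockClassesOfType j 4 3 (basicBlock i).Elem).ncard =
      ∑ i ∈ s, (blockClassesOfType j 4 3 (basicBlock i).Elem).ncard :=
  (s.finite_toSet.ncard_biUnion (fun _ _ => Set.toFinite _)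
    fun _ _ _ _ hne => pairwise_disjoint_blockClassesOfType j hne).trans
    (finsum_mem_coe_finset _ _)

theorem blockClasses_eq_biUnion : blockClasses j 4 3 =
    ⋃ i ∈ Finset.univ, blockClassesOfType j 4 3 (basicBlock i).Elem := by
  ext c
  simp only [Set.mem_iUnion, Finset.mem_univ, exists_const]
  constructor
  · rintro ⟨A, rfl, hA⟩
    obtain ⟨i, hi⟩ := hA.exists_basicBlockHasType
    exact ⟨i, A, rfl, hA, hi⟩
  · rintro ⟨i, A, rfl, hA, -⟩
    exact ⟨A, rfl, hA⟩

theorem blockClassesOfHeight_eq_biUnion (h : ℕ) : blockClassesOfHeight j 4 3 h =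
    ⋃ i ∈ Finset.univ.filter fun i => (basicBlock i).len = h + 1,
      blockClassesOfType j 4 3 (basicBlock i).Elem := by
  ext c
  simp only [Set.mem_iUnion, Finset.mem_filter_univ, exists_prop]
  constructor
  · rintro ⟨A, rfl, hA, hheight⟩
    obtain ⟨i, hlen, hi⟩ := hA.basicBlockHasHeight_iff.1 hheight
    exact ⟨i, hlen, A, rfl, hA, hi⟩
  · rintro ⟨i, hlen, A, rfl, hA, hi⟩
    exact ⟨A, rfl, hA, hA.basicBlockHasHeight_iff.2 ⟨i, hlen, hi⟩⟩

theorem ncard_blockClasses : (blockClasses j 4 3).ncard =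
    ∑ i : Fin 22, (blockClassesOfType j 4 3 (basicBlock i).Elem).ncard := by
  rw [blockClasses_eq_biUnion, ncard_biUnion_blockClassesOfType]

theorem sum_ncard_blockClassesOfHeight :
    ∑ h ∈ Finset.Icc 3 6, (blockClassesOfHeight j 4 3 h).ncard =
      ∑ i : Fin 22, (blockClassesOfType j 4 3 (basicBlock i).Elem).ncard := by
  have len_mem : ∀ i, (basicBlock i).len - 1 ∈ Finset.Icc 3 6 := by decide
  have len_eq : ∀ h ∈ Finset.Icc 3 6, ∀ i,
      (basicBlock i).len = h + 1 ↔ (basicBlock i).len - 1 = h := by decide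
  rw [← Finset.sum_fiberwise_of_maps_to fun i _ => len_mem i]
  refine Finset.sum_congr rfl fun h hh => ?_
  rw [blockClassesOfHeight_eq_biUnion, ncard_biUnion_blockClassesOfType,
    Finset.filter_congr fun i _ => len_eq h hh i]

end Counting

theorem mainTheorem2 (j : ℕ) (hj : 7 ≤ j) :
    (blockClasses j 4 3).ncard
        = ∑ h ∈ Finset.Icc 3 6, (blockClassesOfHeight j 4 3 h).ncard ∧
      ∑ h ∈ Finset.Icc 3 6, (blockClassesOfHeight j 4 3 h).ncard
        = ∑ i : Fin 22, (blockClassesOfType j 4 3 (basicBlock i).Elem).ncard :=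
  ⟨(ncard_blockClasses j).trans (sum_ncard_blockClassesOfHeight j).symm,
    sum_ncard_blockClassesOfHeight j⟩
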